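/- Let $d,m\ge 0$ be integers and let $\mathbb H[x_1,\dots,x_d]$ be the ring of quaternionic polynomials in $d$ central variables. For $f=\sum c_{i_1,\dots,i_d}x_1^{i_1}\cdots x_d^{i_d}$ and $a\in\mathbb H^d$ put $f(a)=\sum c_{i_1,\dots,i_d}a_1^{i_1}\cdots a_d^{i_d}$. A point $a\in\mathbb H^d$ is called good if $a_ia_j=a_ja_i$ for all $i,j$. Every element of $\mathbb H[x_1,\dots,x_d]$ is uniquely of the form $p+\mathbf j q$ with $p,q\in\mathbb C[x_1,\dots,x_d]$; writing $\bar p$ for the polynomial obtained from $p$ by conjugating its coefficients, let $$\varphi:\mathbb H[x_1,\dots,x_d]\to M_2(\mathbb C[x_1,\dots,x_d]),\qquad \varphi(p+\mathbf j q)=\begin{bmatrix}p&-\bar q\\ q&\bar p\end{bmatrix},$$ which is a ring homomorphism. A left ideal $J$ of a unital ring $A$ is called semiprime if for every $a\in A$ with $aAa\subseteq J$ we have $a\in J$. Theorem 6.3. Let $g_1,\dots,g_m\in\mathbb H[x_1,\dots,x_d]$, let $I$ be the left ideal of $\mathbb H[x_1,\dots,x_d]$ generated by $g_1,\dots,g_m$,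 and let $I'$ be the left ideal of $M_2(\mathbb C[x_1,\dots,x_d])$ generated by $\varphi(g_1),\dots,\varphi(g_m)$. For every $f\in\mathbb H[x_1,\dots,x_d]$ the following are equivalent. 1. For every good point $a\in\mathbb H^d$ such that $g_1(a)=\dots=g_m(a)=0$ we have $f(a)=0$. 2. For every $c\in\mathbb C^d$ and $u,v\in\mathbb C$ such that $\varphi(g_i)(c)\begin{bmatrix}u\\v\end{bmatrix}=0$ for $i=1,\dots,m$ we have $\varphi(f)(c)\begin{bmatrix}u\\v\end{bmatrix}=0$. 3. $\varphi(f)$ belongs to the smallest semiprime left ideal of $M_2(\mathbb C[x_1,\dots,x_d])$ containing $I'$. 4. $f$ belongs to the smallest semiprime left ideal of $\mathbb H[x_1,\dots,x_d]$ containing $I$. 5. For every $A\in M_2(\mathbb C)$ there exists an integer $N\ge 0$ such that $(A\varphi(f))^N\in I'+I'(A\varphi(f))+\dots+I'(A\varphi(f))^N$. 6. For every $b\in\mathbb H$ there exists an integer $N\ge 0$ such that $(bf)^N\in I+I(bf)+\dots+I(bf)^N$. -/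

import Mathlib

/-- A left ideal `I` of a (possibly noncommutative) unital ring `A` is semiprime if
`a A a ⊆ I` implies `a ∈ I`. (For a noncommutative ring, Mathlib's `Ideal A` is the type of
left ideals.) -/
def IsSemiprimeLeftIdeal {A : Type*} [Ring A] (I : Ideal A) : Prop :=
  ∀ a : A, (∀ x : A, a * x * a ∈ I) → a ∈ I

/-- The smallest semiprime left ideal containing `I`, i.e. the intersection of all semiprime
left ideals containing `I`; see `isLeast_semiprimeClosure`. -/
def semiprimeClosure {A : Type*} [Ring A] (I : Ideal A) : Ideal A :=
  sInf {J : Ideal A | I ≤ J ∧ IsSemiprimeLeftIdeal J}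

theorem isLeast_semiprimeClosure {A : Type*} [Ring A] (I : Ideal A) :
    IsLeast {J : Ideal A | I ≤ J ∧ IsSemiprimeLeftIdeal J} (semiprimeClosure I) := by
  refine ⟨⟨le_sInf fun J hJ => hJ.1, fun a ha => ?_⟩, fun J hJ => sInf_le hJ⟩
  rw [semiprimeClosure, Submodule.mem_sInf]
  intro J hJ
  exact hJ.2 a fun x => (Submodule.mem_sInf.1 (ha x)) J hJ

/-- The subset `I + I x + ⋯ + I x ^ N` of the ring `A`, for a left ideal `I` and `x : A`. -/
def idealPowerSum {A : Type*} [Ring A] (I : Ideal A) (x : A) (N : ℕ) : Set A :=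
  {y | ∃ h : ℕ → A, (∀ k, h k ∈ I) ∧ y = ∑ k ∈ Finset.range (N + 1), h k * x ^ k}

/-- The ring `ℍ[x₁, …, x_d]` of quaternionic polynomials in `d` central variables:
finite formal sums `∑ c_I x^I` with `c_I ∈ ℍ`, where the monomials `x^I` are central. -/
abbrev QuatPoly (d : ℕ) : Type := AddMonoidAlgebra (Quaternion ℝ) (Fin d →₀ ℕ)

/-- The value `f(a) = ∑ c_I a₁ ^ i₁ ⋯ a_d ^ i_d` of a quaternionic polynomial, with the
coefficients on the left and the powers multiplied in the order of the variables. -/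
noncomputable def quatEval {d : ℕ} (a : Fin d → Quaternion ℝ) (f : QuatPoly d) : Quaternion ℝ :=
  f.coeff.sum fun I c => c * (List.ofFn fun i => a i ^ I i).prod

/-- A point of `ℍ^d` is good if its components commute pairwise. -/
def IsGoodPoint {d : ℕ} (a : Fin d → Quaternion ℝ) : Prop :=
  ∀ i j, a i * a j = a j * a i

/-- The complex number `p` in the decomposition `c = p + 𝐣 q` of a quaternion. -/
def quatFst : Quaternion ℝ →+ ℂ where
  toFun c := ⟨c.re, c.imI⟩
  map_zero' := by apply Complex.ext <;> simp <;> rfl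
  map_add' x y := by apply Complex.ext <;> simp

/-- The complex number `q` in the decomposition `c = p + 𝐣 q` of a quaternion; note that
`𝐣 (s + t 𝐢) = s 𝐣 - t 𝐤`. -/
def quatSnd : Quaternion ℝ →+ ℂ where
  toFun c := ⟨c.imJ, -c.imK⟩
  map_zero' := by apply Complex.ext <;> simp <;> rfl
  map_add' x y := by apply Complex.ext <;> simp [add_comm]

/-- The quaternion unit `𝐣`. -/
def quatJ : Quaternion ℝ := ⟨0, 0, 1, 0⟩

theorem quat_eq_fst_add_j_mul_snd (c : Quaternion ℝ) :
    c = (quatFst c : Quaternion ℝ) + quatJ * (quatSnd c : Quaternion ℝ) := by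
  have h0 : quatJ.re = 0 := rfl
  have h1 : quatJ.imI = 0 := rfl
  have h2 : quatJ.imJ = 1 := rfl
  have h3 : quatJ.imK = 0 := rfl
  ext <;> simp [quatFst, quatSnd, h0, h1, h2, h3]

/-- The polynomial `p` in the decomposition `f = p + 𝐣 q`, with `p, q ∈ ℂ[x₁, …, x_d]`. -/
noncomputable def polyFst {d : ℕ} (f : QuatPoly d) : MvPolynomial (Fin d) ℂ :=
  AddMonoidAlgebra.map quatFst f

/-- The polynomial `q` in the decomposition `f = p + 𝐣 q`, with `p, q ∈ ℂ[x₁, …, x_d]`. -/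
noncomputable def polySnd {d : ℕ} (f : QuatPoly d) : MvPolynomial (Fin d) ℂ :=
  AddMonoidAlgebra.map quatSnd f

/-- Conjugation of all coefficients of a complex polynomial. -/
noncomputable def polyConj {d : ℕ} : MvPolynomial (Fin d) ℂ →+* MvPolynomial (Fin d) ℂ :=
  MvPolynomial.map (starRingEnd ℂ)

theorem polyFst_add {d : ℕ} (f g : QuatPoly d) : polyFst (f + g) = polyFst f + polyFst g :=
  AddMonoidAlgebra.map_add _ _ _

theorem polySnd_add {d : ℕ} (f g : QuatPoly d) : polySnd (f + g) = polySnd f + polySnd g :=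
  AddMonoidAlgebra.map_add _ _ _

theorem polyFst_zero {d : ℕ} : polyFst (0 : QuatPoly d) = 0 :=
  AddMonoidAlgebra.map_zero _

theorem polySnd_zero {d : ℕ} : polySnd (0 : QuatPoly d) = 0 :=
  AddMonoidAlgebra.map_zero _

theorem polyFst_single {d : ℕ} (m : Fin d →₀ ℕ) (c : Quaternion ℝ) :
    polyFst (AddMonoidAlgebra.single m c) = MvPolynomial.monomial m (quatFst c) :=
  AddMonoidAlgebra.map_single _ _ _

theorem polySnd_single {d : ℕ} (m : Fin d →₀ ℕ) (c : Quaternion ℝ) :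
    polySnd (AddMonoidAlgebra.single m c) = MvPolynomial.monomial m (quatSnd c) :=
  AddMonoidAlgebra.map_single _ _ _

theorem quatFst_mul (x y : Quaternion ℝ) :
    quatFst (x * y) = quatFst x * quatFst y - starRingEnd ℂ (quatSnd x) * quatSnd y := by
  apply Complex.ext <;> simp [quatFst, quatSnd] <;> ring

theorem quatSnd_mul (x y : Quaternion ℝ) :
    quatSnd (x * y) = quatSnd x * quatFst y + starRingEnd ℂ (quatFst x) * quatSnd y := by
  apply Complex.ext <;> simp [quatFst, quatSnd] <;> ring

theorem polyFst_mul {d : ℕ} (f g : QuatPoly d) :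
    polyFst (f * g) = polyFst f * polyFst g - polyConj (polySnd f) * polySnd g := by
  induction f using AddMonoidAlgebra.induction_linear with
  | zero => simp [polyFst_zero, polySnd_zero]
  | add f₁ f₂ h₁ h₂ => rw [add_mul, polyFst_add, h₁, h₂, polyFst_add, polySnd_add, map_add]; ring
  | single m c =>
    induction g using AddMonoidAlgebra.induction_linear with
    | zero => simp [polyFst_zero, polySnd_zero]
    | add f₁ f₂ h₁ h₂ => rw [mul_add, polyFst_add, h₁, h₂, polyFst_add, polySnd_add]; ring
    | single n e =>
      rw [AddMonoidAlgebra.single_mul_single]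
      simp only [polyFst_single, polySnd_single, polyConj, MvPolynomial.map_monomial,
        MvPolynomial.monomial_mul, quatFst_mul, map_sub]

theorem polySnd_mul {d : ℕ} (f g : QuatPoly d) :
    polySnd (f * g) = polySnd f * polyFst g + polyConj (polyFst f) * polySnd g := by
  induction f using AddMonoidAlgebra.induction_linear with
  | zero => simp [polyFst_zero, polySnd_zero]
  | add f₁ f₂ h₁ h₂ => rw [add_mul, polySnd_add, h₁, h₂, polyFst_add, polySnd_add, map_add]; ring
  | single m c =>
    induction g using AddMonoidAlgebra.induction_linear with
    | zero => simp [polyFst_zero, polySnd_zero]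
    | add f₁ f₂ h₁ h₂ => rw [mul_add, polySnd_add, h₁, h₂, polyFst_add, polySnd_add]; ring
    | single n e =>
      rw [AddMonoidAlgebra.single_mul_single]
      simp only [polyFst_single, polySnd_single, polyConj, MvPolynomial.map_monomial,
        MvPolynomial.monomial_mul, quatSnd_mul, map_add]

theorem polyConj_polyConj {d : ℕ} (p : MvPolynomial (Fin d) ℂ) : polyConj (polyConj p) = p := by
  have h : (starRingEnd ℂ).comp (starRingEnd ℂ) = RingHom.id ℂ := by ext z; simp
  rw [polyConj, MvPolynomial.map_map, h, MvPolynomial.map_id]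

theorem polyFst_one {d : ℕ} : polyFst (1 : QuatPoly d) = 1 := by
  rw [AddMonoidAlgebra.one_def, polyFst_single]
  have h : quatFst 1 = 1 := by apply Complex.ext <;> simp [quatFst] <;> rfl
  rw [h]; rfl

theorem polySnd_one {d : ℕ} : polySnd (1 : QuatPoly d) = 0 := by
  rw [AddMonoidAlgebra.one_def, polySnd_single]
  have h : quatSnd 1 = 0 := by apply Complex.ext <;> simp [quatSnd] <;> rfl
  rw [h, map_zero]

/-- The embedding `φ : ℍ[x₁, …, x_d] → M₂(ℂ[x₁, …, x_d])`, a ring homomorphism, given by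
`φ(p + 𝐣 q) = [[p, -q̄], [q, p̄]]`. -/
noncomputable def quatEmbed (d : ℕ) :
    QuatPoly d →+* Matrix (Fin 2) (Fin 2) (MvPolynomial (Fin d) ℂ) where
  toFun f := !![polyFst f, -polyConj (polySnd f); polySnd f, polyConj (polyFst f)]
  map_one' := by
    ext i j; fin_cases i <;> fin_cases j <;> simp [polyFst_one, polySnd_one]
  map_mul' f g := by
    rw [Matrix.mul_fin_two]
    simp only [polyFst_mul, polySnd_mul, map_sub, map_add, map_mul, polyConj_polyConj]
    ext i j; fin_cases i <;> fin_cases j <;> simp <;> ring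
  map_zero' := by
    ext i j; fin_cases i <;> fin_cases j <;> simp [polyFst_zero, polySnd_zero]
  map_add' f g := by
    ext i j; fin_cases i <;> fin_cases j <;> simp [polyFst_add, polySnd_add, add_comm]

/-- The value `F(c) ∈ M₂(ℂ)` of a matrix polynomial at a point `c ∈ ℂ^d`. -/
noncomputable def matEval {d : ℕ} (c : Fin d → ℂ)
    (F : Matrix (Fin 2) (Fin 2) (MvPolynomial (Fin d) ℂ)) : Matrix (Fin 2) (Fin 2) ℂ :=
  F.map (MvPolynomial.eval c)

/-- A constant complex matrix regarded as a matrix polynomial. -/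
noncomputable def matConst {d : ℕ} (A : Matrix (Fin 2) (Fin 2) ℂ) :
    Matrix (Fin 2) (Fin 2) (MvPolynomial (Fin d) ℂ) :=
  A.map MvPolynomial.C

/-- A quaternion regarded as a constant quaternionic polynomial. -/
noncomputable def quatConst {d : ℕ} (b : Quaternion ℝ) : QuatPoly d :=
  AddMonoidAlgebra.single 0 b

/-!
For 2 ⇒ 3, left ideals of `Mₙ(S)` correspond to submodules of `Sⁿ` through their rows. A row outside
a semiprime submodule `N` of `Sⁿ` has a multiple `t` whose annihilator modulo `N` is a prime `𝔭`;
semiprimeness makes the image of `t` in `(S/𝔭)ⁿ` torsion-free modulo `N`, so that a linear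
functional over the fraction field of `S/𝔭` separates `t` from `N`, and the Nullstellensatz
specializes it to a point `c` and a vector `w`.

For 2 ⇒ 5, if no power of the indeterminate `X` lies in the left ideal generated by `I'` and
`X - F`, then the Nullstellensatz yields a point `c` and a vector `w` killed by `I'(c)` that is an
eigenvector of `F(c)` for a nonzero eigenvalue; for `F = A φ(f)` this contradicts 2.

For 3 ⇒ 4 and 5 ⇒ 6, `φ` identifies `ℍ[x]` with the fixed ring of an involution `σ` of
`M₂(ℂ[x])`, and the trace `F ↦ F + σ F` transports the statements back to `ℍ[x]`.

The remaining implications rest on the action of `ℍ[x]` on `ℍ` attached to a good point `a`, where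
`x_i` acts by right multiplication by `a_i` and the value at `a` is the image of `1`. At a complex
point `c` this action is `φ(·)(c)` on `ℂ²`, and the coordinates `(u, v)` of a quaternion `w ≠ 0`
correspond to the good point `w c w⁻¹`.
-/

open Matrix

section RowModule

variable {n S : Type*} [Fintype n] [CommRing S]

/-- The rows of the members of a left ideal `J` of `Mₙ(S)`: the submodule of all `r` such that the
matrices with one row `r` and all other rows zero lie in `J`. The assignment `J ↦ rowModule J` is
the Morita correspondence between left ideals of `Mₙ(S)` and submodules of `Sⁿ`. -/
def rowModule [DecidableEq n] (J : Ideal (Matrix n n S)) : Submodule S (n → S) where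
  carrier := {r | ∀ u : n → S, vecMulVec u r ∈ J}
  add_mem' hr hs u := by
    rw [vecMulVec_add]
    exact J.add_mem (hr u) (hs u)
  zero_mem' u := by
    rw [vecMulVec_zero]
    exact J.zero_mem
  smul_mem' q r hr u := by
    rw [vecMulVec_smul, ← smul_vecMulVec]
    exact hr (q • u)

variable [DecidableEq n] {J : Ideal (Matrix n n S)}

theorem mem_iff_forall_row_mem_rowModule {F : Matrix n n S} :
    F ∈ J ↔ ∀ i, F.row i ∈ rowModule J := by
  refine ⟨fun hF i u => ?_, fun h => ?_⟩
  · rw [← F.single_one_vecMul i, ← vecMulVec_mul]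
    exact J.mul_mem_left _ hF
  · rw [show F = ∑ i, vecMulVec (Pi.single i 1) (F.row i) by
      ext k l
      simp [Matrix.sum_apply, vecMulVec_apply, Pi.single_apply]]
    exact J.sum_mem fun i _ => h i _

/-- A submodule of `Sⁿ` is semiprime if it contains `r` as soon as it contains all multiples
`rⱼ r` of `r` by its own coordinates. For `n = 1` these are the radical ideals of `S`. -/
def IsSemiprimeSubmodule {ι S : Type*} [CommRing S] (N : Submodule S (ι → S)) : Prop :=
  ∀ r : ι → S, (∀ j, r j • r ∈ N) → r ∈ N

theorem isSemiprimeSubmodule_rowModule (hJ : IsSemiprimeLeftIdeal J) :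
    IsSemiprimeSubmodule (rowModule J) := by
  refine fun r hr u => hJ _ fun X => ?_
  have hmem : (r ⬝ᵥ X *ᵥ u) • r ∈ rowModule J := by
    rw [dotProduct, Finset.sum_smul]
    refine Submodule.sum_mem _ fun j _ => ?_
    rw [mul_comm, mul_smul]
    exact Submodule.smul_mem _ _ (hr j)
  rw [mul_assoc, mul_vecMulVec, vecMulVec_mul_vecMulVec]
  exact hmem u

theorem exists_ne_zero_forall_mulVec_eq_zero {K : Type*} [Field K] {L : Ideal (Matrix n n K)}
    (hL : L ≠ ⊤) : ∃ w : n → K, w ≠ 0 ∧ ∀ z ∈ L, z *ᵥ w = 0 := by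
  have hrow : rowModule L < ⊤ := lt_top_iff_ne_top.2 fun h =>
    hL ((Ideal.eq_top_iff_one _).2 (mem_iff_forall_row_mem_rowModule.2 fun _ => h ▸ trivial))
  obtain ⟨θ, hθ, hker⟩ := Submodule.exists_le_ker_of_lt_top _ hrow
  obtain ⟨w, rfl⟩ := (dotProductEquiv K n).surjective θ
  refine ⟨w, fun h => hθ (by rw [h, map_zero]), fun z hz => funext fun i => ?_⟩
  rw [mulVec, dotProduct_comm]
  exact hker (mem_iff_forall_row_mem_rowModule.1 hz i)

end RowModule

section Separation

theorem exists_isPrime_colon_smul {S M : Type*} [CommRing S] [IsNoetherianRing S]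
    [AddCommGroup M] [Module S M] {N : Submodule S M} {r : M} (hr : r ∉ N) :
    ∃ s : S, (N.colon {s • r}).IsPrime := by
  let x : Submodule.span S {N.mkQ r} := ⟨N.mkQ r, Submodule.mem_span_singleton_self _⟩
  have hx : x ≠ 0 := fun h =>
    hr ((Submodule.Quotient.mk_eq_zero N).1 (congrArg Subtype.val h))
  obtain ⟨𝔭, h𝔭, -⟩ := exists_le_isAssociatedPrime_of_isNoetherianRing S x hx
  obtain ⟨hprime, ⟨_, hz⟩, rfl⟩ := isAssociatedPrime_iff.1 h𝔭
  obtain ⟨s, rfl⟩ := Submodule.mem_span_singleton.1 hz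
  refine ⟨s, ?_⟩
  convert hprime using 1
  ext q
  rw [Submodule.mem_colon_singleton, Submodule.mem_colon_singleton, Submodule.mem_bot,
    ← Submodule.Quotient.mk_eq_zero, ← Subtype.coe_inj]
  rfl

theorem exists_dotProduct_ne_zero {n D : Type*} [Fintype n] [CommRing D] [IsDomain D]
    {N : Submodule D (n → D)} {t : n → D} (ht : ∀ q : D, q ≠ 0 → q • t ∉ N) :
    ∃ w : n → D, (∀ y ∈ N, y ⬝ᵥ w = 0) ∧ t ⬝ᵥ w ≠ 0 := by
  classical
  let K := FractionRing D
  let ι : (n → D) →ₗ[D] (n → K) :=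
    LinearMap.pi fun i => Algebra.linearMap D K ∘ₗ LinearMap.proj i
  have hι : Function.Injective ι := fun y z h => funext fun i =>
    IsFractionRing.injective D K (congrFun h i)
  have hmem : ι t ∉ N.localized' K (nonZeroDivisors D) ι := by
    rw [Submodule.mem_localized']
    rintro ⟨y, hy, q, h⟩
    rw [IsLocalizedModule.mk'_eq_iff, Submonoid.smul_def, ← map_smul] at h
    exact ht q (nonZeroDivisors.coe_ne_zero q) (hι h ▸ hy)
  obtain ⟨θ, hθt, hθN⟩ := Submodule.exists_le_ker_of_notMem hmem
  obtain ⟨v, rfl⟩ := (dotProductEquiv K n).surjective θ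
  obtain ⟨b, hb⟩ := IsLocalization.exist_integer_multiples_of_finite (nonZeroDivisors D) v
  choose w hw using hb
  have hb0 : algebraMap D K b ≠ 0 :=
    IsFractionRing.to_map_ne_zero_of_mem_nonZeroDivisors b.2
  have hdot : ∀ y : n → D, algebraMap D K (y ⬝ᵥ w) = algebraMap D K b * (v ⬝ᵥ ι y) := fun y => by
    simp only [dotProduct, map_sum, map_mul, hw, Finset.mul_sum, Algebra.smul_def]
    exact Finset.sum_congr rfl fun i _ => (mul_comm _ _).trans (mul_assoc _ _ _)
  refine ⟨w, fun y hy => IsFractionRing.injective D K ?_, fun h => ?_⟩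
  · have hy0 : v ⬝ᵥ ι y = 0 :=
      hθN (Submodule.mem_localized' .. |>.2 ⟨y, hy, 1, IsLocalizedModule.mk'_one _ _ _⟩)
    rw [hdot, hy0, mul_zero, map_zero]
  · have h0 := hdot t
    rw [h, map_zero] at h0
    exact hθt ((mul_eq_zero.1 h0.symm).resolve_left hb0)

theorem IsSemiprimeSubmodule.mem_colon_of_forall_sub_mem {n S : Type*} [CommRing S]
    {N : Submodule S (n → S)} (hN : IsSemiprimeSubmodule N) {t y : n → S} (hy : y ∈ N) {q : S}
    (h : ∀ j, (q • t - y) j ∈ N.colon {t}) : q ∈ N.colon {t} := by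
  simp only [Submodule.mem_colon_singleton] at h ⊢
  have hmem : q • t - y ∈ N := hN _ fun j => by
    rw [smul_sub, smul_comm]
    exact N.sub_mem (N.smul_mem q (h j)) (N.smul_mem _ hy)
  simpa only [sub_add_cancel] using N.add_mem hmem hy

theorem IsSemiprimeSubmodule.exists_isPrime_dotProduct_notMem {n S : Type*} [Fintype n]
    [CommRing S] [IsNoetherianRing S] {N : Submodule S (n → S)} (hN : IsSemiprimeSubmodule N)
    {r : n → S} (hr : r ∉ N) :
    ∃ (𝔭 : Ideal S) (w : n → S), 𝔭.IsPrime ∧ (∀ y ∈ N, y ⬝ᵥ w ∈ 𝔭) ∧ r ⬝ᵥ w ∉ 𝔭 := by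
  obtain ⟨s, hprime⟩ := exists_isPrime_colon_smul hr
  set t := s • r
  set 𝔭 := N.colon {t}
  let π : (n → S) →ₛₗ[Ideal.Quotient.mk 𝔭] (n → S ⧸ 𝔭) :=
    { toFun := fun y i => Ideal.Quotient.mk 𝔭 (y i)
      map_add' := fun y z => funext fun i => map_add _ (y i) (z i)
      map_smul' := fun q y => funext fun i => map_mul _ q (y i) }
  have htors : ∀ q : S ⧸ 𝔭, q ≠ 0 → q • π t ∉ N.map π := by
    intro q hq
    obtain ⟨q, rfl⟩ := Ideal.Quotient.mk_surjective q
    rw [← π.map_smulₛₗ]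
    rintro ⟨y, hy, h⟩
    exact hq (Ideal.Quotient.eq_zero_iff_mem.2
      (hN.mem_colon_of_forall_sub_mem hy fun j => Ideal.Quotient.eq.1 (congrFun h j).symm))
  obtain ⟨w, hwN, hwt⟩ := exists_dotProduct_ne_zero htors
  obtain ⟨w, rfl⟩ := Ideal.Quotient.mk_surjective.comp_left w
  have hdot : ∀ y : n → S, Ideal.Quotient.mk 𝔭 (y ⬝ᵥ w) = π y ⬝ᵥ (Ideal.Quotient.mk 𝔭 ∘ w) :=
    fun y => RingHom.map_dotProduct (Ideal.Quotient.mk 𝔭) y w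
  refine ⟨𝔭, w, hprime, fun y hy => ?_, fun h => hwt ?_⟩
  · rw [← Ideal.Quotient.eq_zero_iff_mem, hdot]
    exact hwN _ (Submodule.mem_map_of_mem hy)
  · rw [← hdot, Ideal.Quotient.eq_zero_iff_mem, smul_dotProduct]
    exact 𝔭.mul_mem_left s h

theorem exists_algHom_of_notMem_radical {k K S : Type*} [Field k] [Field K] [Algebra k K]
    [IsAlgClosed K] [CommRing S] [Algebra k S] [Algebra.FiniteType k S] {𝔞 : Ideal S} {x : S}
    (hx : x ∉ 𝔞.radical) : ∃ χ : S →ₐ[k] K, (∀ a ∈ 𝔞, χ a = 0) ∧ χ x ≠ 0 := by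
  obtain ⟨n, π, hπ⟩ := Algebra.FiniteType.iff_quotient_mvPolynomial''.1 ‹Algebra.FiniteType k S›
  obtain ⟨p, rfl⟩ := hπ x
  have hp : p ∉ (𝔞.comap π).radical := by
    rwa [← Ideal.comap_radical]
  rw [← MvPolynomial.vanishingIdeal_zeroLocus_eq_radical (K := K),
    MvPolynomial.mem_vanishingIdeal_iff] at hp
  push Not at hp
  obtain ⟨c, hc, hpc⟩ := hp
  have hker : RingHom.ker π.toRingHom ≤ RingHom.ker (MvPolynomial.aeval c).toRingHom := by
    intro q hq
    refine hc q (Ideal.mem_comap.2 ?_)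
    rw [show π q = 0 from hq]
    exact 𝔞.zero_mem
  let χ := AlgHom.liftOfSurjective π hπ (MvPolynomial.aeval c) hker
  have hχ : ∀ q, χ (π q) = MvPolynomial.aeval c q :=
    AlgHom.liftOfSurjective_apply π hπ _ hker
  refine ⟨χ, fun a ha => ?_, ?_⟩
  · obtain ⟨q, rfl⟩ := hπ a
    rw [hχ]
    exact hc q ha
  · rwa [hχ]

theorem IsSemiprimeLeftIdeal.exists_algHom_mulVec_ne_zero {n K S : Type*} [Fintype n]
    [DecidableEq n] [Field K] [IsAlgClosed K] [CommRing S] [Algebra K S] [Algebra.FiniteType K S]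
    {J : Ideal (Matrix n n S)} (hJ : IsSemiprimeLeftIdeal J) {F : Matrix n n S} (hF : F ∉ J) :
    ∃ (χ : S →ₐ[K] K) (w : n → K), (∀ z ∈ J, z.map χ *ᵥ w = 0) ∧ F.map χ *ᵥ w ≠ 0 := by
  have : IsNoetherianRing S := Algebra.FiniteType.isNoetherianRing K S
  obtain ⟨i, hi⟩ : ∃ i, F.row i ∉ rowModule J :=
    not_forall.1 (mt mem_iff_forall_row_mem_rowModule.2 hF)
  obtain ⟨𝔭, w, h𝔭, hwJ, hwF⟩ :=
    (isSemiprimeSubmodule_rowModule hJ).exists_isPrime_dotProduct_notMem hi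
  rw [← h𝔭.radical] at hwF
  obtain ⟨χ, hχ𝔭, hχF⟩ := exists_algHom_of_notMem_radical (k := K) (K := K) hwF
  have hdot : ∀ (z : Matrix n n S) k, (z.map χ *ᵥ (χ ∘ w)) k = χ (z.row k ⬝ᵥ w) := fun z k =>
    (RingHom.map_dotProduct χ.toRingHom (z.row k) w).symm
  refine ⟨χ, χ ∘ w, fun z hz => funext fun k => ?_, fun h => hχF ?_⟩
  · rw [hdot]
    exact hχ𝔭 _ (hwJ _ (mem_iff_forall_row_mem_rowModule.1 hz k))
  · rw [← hdot, h, Pi.zero_apply]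

end Separation

section PowerSums

open Polynomial

theorem coeff_mem_of_mem_map_C {A : Type*} [Ring A] {I : Ideal A} {q : A[X]}
    (hq : q ∈ I.map (C : A →+* A[X])) (k : ℕ) : q.coeff k ∈ I := by
  induction hq using Submodule.span_induction generalizing k with
  | mem _ hz =>
    obtain ⟨z, hz, rfl⟩ := hz
    rw [coeff_C]
    split_ifs
    exacts [hz, I.zero_mem]
  | zero => exact I.zero_mem
  | add p q _ _ hp hq => exact I.add_mem (hp k) (hq k)
  | smul r p _ hp =>
    rw [smul_eq_mul, coeff_mul]
    exact I.sum_mem fun _ _ => I.mul_mem_left _ (hp _)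

-- Evaluating at `x` sends the first summand into the sums `∑ hₖ xᵏ` with `hₖ ∈ I`; multiplying
-- by a power of `x` then makes the exponent on the left at least the number of terms.
theorem exists_pow_mem_idealPowerSum {A : Type*} [Ring A] {I : Ideal A} {x : A} {n : ℕ}
    (h : (X : A[X]) ^ n ∈ I.map C ⊔ Ideal.span {X - C x}) :
    ∃ N, x ^ N ∈ idealPowerSum I x N := by
  obtain ⟨q, hq, p, hp, hqp⟩ := Submodule.mem_sup.1 h
  obtain ⟨p, rfl⟩ := Submodule.mem_span_singleton.1 hp
  have hx : x ^ n = q.eval x := by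
    rw [← eval_X_pow (n := n), ← hqp, eval_add, smul_eq_mul, eval_mul_X_sub_C, add_zero]
  refine ⟨n + q.natDegree, fun k => x ^ q.natDegree * q.coeff k,
    fun k => I.mul_mem_left _ (coeff_mem_of_mem_map_C hq k), ?_⟩
  rw [add_comm, pow_add, hx, eval_eq_sum_range' (n := q.natDegree + n + 1) (by lia),
    Finset.mul_sum]
  simp only [mul_assoc]

variable {n K : Type*} [Fintype n] [DecidableEq n] [Field K] [IsAlgClosed K]

theorem exists_algHom_mulVec_eq_zero_of_notMem_radical {T : Type*} [CommRing T] [Algebra K T]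
    [Algebra.FiniteType K T] {L : Ideal (Matrix n n T)} {x : T}
    (hx : x ∉ (L.comap (scalar n)).radical) :
    ∃ (χ : T →ₐ[K] K) (w : n → K), w ≠ 0 ∧ χ x ≠ 0 ∧ ∀ z ∈ L, z.map χ *ᵥ w = 0 := by
  obtain ⟨χ, hχ, hχx⟩ := exists_algHom_of_notMem_radical (k := K) (K := K) hx
  let ψ : Matrix n n T →+* Matrix n n K := χ.toRingHom.mapMatrix
  have hψ : Function.Surjective ψ := fun Z =>
    ⟨Z.map (algebraMap K T), by ext i j; exact χ.commutes _⟩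
  have hproper : L.map ψ ≠ ⊤ := by
    rw [Ne, Ideal.eq_top_iff_one, Ideal.mem_map_iff_of_surjective ψ hψ]
    rintro ⟨y, hy, hy1⟩
    have hdet : y.det ∈ L.comap (scalar n) := by
      rw [Ideal.mem_comap, scalar_apply, ← smul_one_eq_diagonal, ← adjugate_mul]
      exact L.mul_mem_left _ hy
    have hdet1 : χ y.det = (ψ y).det := χ.toRingHom.map_det y
    rw [hχ _ hdet, hy1, det_one] at hdet1
    exact zero_ne_one hdet1
  obtain ⟨w, hw, hLw⟩ := exists_ne_zero_forall_mulVec_eq_zero hproper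
  exact ⟨χ, w, hw, hχx, fun z hz => hLw _ (Ideal.mem_map_of_mem ψ hz)⟩

theorem exists_pow_mem_idealPowerSum_of_eigenvalues_eq_zero {S : Type*} [CommRing S]
    [Algebra K S] [Algebra.FiniteType K S] {I : Ideal (Matrix n n S)} {F : Matrix n n S}
    (h : ∀ (χ : S →ₐ[K] K) (w : n → K), w ≠ 0 → (∀ z ∈ I, z.map χ *ᵥ w = 0) →
      ∀ t : K, F.map χ *ᵥ w = t • w → t = 0) :
    ∃ N, F ^ N ∈ idealPowerSum I F N := by
  let e : Matrix n n S[X] →+* (Matrix n n S)[X] := matPolyEquiv.toRingEquiv.toRingHom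
  let L : Ideal (Matrix n n S[X]) := (I.map C ⊔ Ideal.span {X - C F}).comap e
  by_cases hX : (X : S[X]) ∈ (L.comap (scalar n)).radical
  · obtain ⟨k, hk⟩ := hX
    refine exists_pow_mem_idealPowerSum (n := k) ?_
    have hmem : e (scalar n (X ^ k)) ∈ I.map C ⊔ Ideal.span {X - C F} := hk
    rwa [map_pow, map_pow, show e (scalar n X) = X from matPolyEquiv_diagonal_X] at hmem
  obtain ⟨χ, w, hw, hχX, hLw⟩ := exists_algHom_mulVec_eq_zero_of_notMem_radical (K := K) hX
  let χ₀ : S →ₐ[K] K := χ.comp ((CAlgHom : S →ₐ[S] S[X]).restrictScalars K)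
  have hI : ∀ z ∈ I, z.map χ₀ *ᵥ w = 0 := fun z hz => by
    refine hLw (z.map C) (Ideal.mem_comap.2 ?_)
    rw [show e (z.map C) = C z from matPolyEquiv_map_C z]
    exact Ideal.mem_sup_left (Ideal.mem_map_of_mem C hz)
  have hF : F.map χ₀ *ᵥ w = χ X • w := by
    have hchar : charmatrix F ∈ L := by
      rw [Ideal.mem_comap, show e (charmatrix F) = X - C F from matPolyEquiv_charmatrix F]
      exact Ideal.mem_sup_right (Ideal.mem_span_singleton_self _)
    have hmap : (charmatrix F).map χ = χ X • (1 : Matrix n n K) - F.map χ₀ := by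
      ext i j
      simp [charmatrix_apply, Matrix.one_apply, diagonal_apply, apply_ite χ, χ₀]
    have hzero := hLw _ hchar
    rw [hmap, sub_mulVec, smul_mulVec, one_mulVec, sub_eq_zero] at hzero
    exact hzero.symm
  exact absurd (h χ₀ w hw hI _ hF) hχX

end PowerSums

section FixedRing

variable {A B : Type*} [Ring A] [Ring B] {φ : A →+* B} {σ : B →+* B}

/-- The ring homomorphism `φ : A → B` identifies `A` with the ring of fixed points of the
involution `σ` of `B`. For `φ : ℍ[x] → M₂(ℂ[x])` this is a Galois descent datum, `σ` being the
conjugation of `M₂(ℂ[x]) = ℂ ⊗ ℍ[x]`. -/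
structure IsFixedRing (φ : A →+* B) (σ : B →+* B) : Prop where
  injective : Function.Injective φ
  involutive : Function.Involutive σ
  mem_range_iff : ∀ F, F ∈ φ.range ↔ σ F = F

namespace IsFixedRing

theorem apply_map (h : IsFixedRing φ σ) (a : A) : σ (φ a) = φ a :=
  (h.mem_range_iff _).1 ⟨a, rfl⟩

theorem exists_map_eq_add (h : IsFixedRing φ σ) (F : B) : ∃ a, φ a = F + σ F :=
  (h.mem_range_iff _).2 (by rw [map_add, h.involutive F, add_comm])

/-- The trace `F ↦ F + σ F`, with values in the fixed ring `A`. -/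
noncomputable def trace (h : IsFixedRing φ σ) : B →+ A :=
  AddMonoidHom.mk' (fun F => (h.exists_map_eq_add F).choose) fun F G => h.injective <|
    (h.exists_map_eq_add (F + G)).choose_spec.trans <| by
      rw [map_add φ, (h.exists_map_eq_add F).choose_spec, (h.exists_map_eq_add G).choose_spec,
        map_add σ, add_add_add_comm]

variable (h : IsFixedRing φ σ)

theorem map_trace (F : B) : φ (h.trace F) = F + σ F :=
  (h.exists_map_eq_add F).choose_spec

theorem trace_mul_map (F : B) (a : A) : h.trace (F * φ a) = h.trace F * a :=
  h.injective <| by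
    rw [map_mul φ, map_trace, map_trace, map_mul σ, h.apply_map, add_mul]

theorem trace_map (a : A) : h.trace (φ a) = 2 * a :=
  h.injective <| by rw [map_trace, h.apply_map, two_mul, map_add]

theorem trace_apply (F : B) : h.trace (σ F) = h.trace F :=
  h.injective <| by rw [map_trace, map_trace, h.involutive F, add_comm]

/-- The left ideal of `B` coinduced from a left ideal `J` of `A`: the largest left ideal of `B`
whose trace lies in `J`. -/
def coinduced (J : Ideal A) : Ideal B where
  carrier := {F | ∀ G, h.trace (G * F) ∈ J}
  add_mem' hF hF' G := by
    rw [mul_add, map_add]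
    exact J.add_mem (hF G) (hF' G)
  zero_mem' G := by
    rw [mul_zero, map_zero]
    exact J.zero_mem
  smul_mem' H F hF G := by
    rw [smul_eq_mul, ← mul_assoc]
    exact hF (G * H)

variable {J : Ideal A}

theorem map_le_coinduced : J.map φ ≤ h.coinduced J :=
  Ideal.map_le_iff_le_comap.2 fun a ha G => by
    rw [trace_mul_map]
    exact J.mul_mem_left _ ha

theorem apply_mem_coinduced {F : B} (hF : F ∈ h.coinduced J) : σ F ∈ h.coinduced J := fun G => by
  rw [← h.involutive G, ← map_mul, trace_apply]
  exact hF (σ G)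

theorem mem_of_map_mem_coinduced (h2 : IsUnit (2 : A)) {a : A} (ha : φ a ∈ h.coinduced J) :
    a ∈ J := by
  have h2a := ha 1
  rwa [one_mul, trace_map, J.unit_mul_mem_iff_mem h2] at h2a

theorem mem_coinduced_of_forall_mul_mul_mem (h2 : IsUnit (2 : A)) (hJ : IsSemiprimeLeftIdeal J)
    {P : B} (hP : ∀ x, P * x * P ∈ h.coinduced J) (hPσ : ∀ x, P * x * σ P ∈ h.coinduced J) :
    P ∈ h.coinduced J := by
  refine fun G => hJ _ fun x => h.mem_of_map_mem_coinduced h2 ?_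
  have hGP : G * P * φ x * (G * P) ∈ h.coinduced J := by
    rw [show G * P * φ x * (G * P) = G * (P * (φ x * G) * P) by simp only [mul_assoc]]
    exact Ideal.mul_mem_left _ _ (hP _)
  have hGPσ : G * P * φ x * σ (G * P) ∈ h.coinduced J := by
    rw [show G * P * φ x * σ (G * P) = G * (P * (φ x * σ G) * σ P) by
      simp only [map_mul, mul_assoc]]
    exact Ideal.mul_mem_left _ _ (hPσ _)
  have hexpand : φ (h.trace (G * P) * x * h.trace (G * P)) =
      G * P * φ x * (G * P) + G * P * φ x * σ (G * P) +
        (σ (G * P * φ x * σ (G * P)) + σ (G * P * φ x * (G * P))) := by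
    simp only [map_mul, map_trace, h.apply_map, h.involutive G, h.involutive P]
    noncomm_ring
  rw [hexpand]
  exact add_mem (add_mem hGP hGPσ)
    (add_mem (h.apply_mem_coinduced hGPσ) (h.apply_mem_coinduced hGP))

theorem isSemiprimeLeftIdeal_coinduced (h2 : IsUnit (2 : A)) (hJ : IsSemiprimeLeftIdeal J) :
    IsSemiprimeLeftIdeal (h.coinduced J) := by
  refine fun F hF => h.mem_coinduced_of_forall_mul_mul_mem h2 hJ hF fun y => ?_
  refine h.mem_coinduced_of_forall_mul_mul_mem h2 hJ (fun x => ?_) fun x => ?_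
  · rw [show F * y * σ F * x * (F * y * σ F) = F * y * σ (F * σ (x * F * y) * F) by
      simp only [map_mul, h.involutive _, mul_assoc]]
    exact Ideal.mul_mem_left _ _ (h.apply_mem_coinduced (hF _))
  · rw [show F * y * σ F * x * σ (F * y * σ F) = F * (y * σ F * x * σ F * σ y) * F by
      simp only [map_mul, h.involutive _, mul_assoc]]
    exact hF _

theorem mem_semiprimeClosure_of_map_mem (h : IsFixedRing φ σ) (h2 : IsUnit (2 : A))
    {I : Ideal A} {a : A} (ha : φ a ∈ semiprimeClosure (I.map φ)) : a ∈ semiprimeClosure I := by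
  refine Submodule.mem_sInf.2 fun J ⟨hIJ, hJ⟩ => h.mem_of_map_mem_coinduced h2 ?_
  exact Submodule.mem_sInf.1 ha _
    ⟨(Ideal.map_mono hIJ).trans h.map_le_coinduced, h.isSemiprimeLeftIdeal_coinduced h2 hJ⟩

theorem pow_mem_idealPowerSum_of_map_pow_mem (h : IsFixedRing φ σ) (h2 : IsUnit (2 : A))
    {I : Ideal A} {x : A} {N : ℕ} (hx : φ x ^ N ∈ idealPowerSum (I.map φ) (φ x) N) :
    x ^ N ∈ idealPowerSum I x N := by
  obtain ⟨F, hF, hsum⟩ := hx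
  obtain ⟨u, hu⟩ := h2
  have htrace : (u : A) * x ^ N = ∑ k ∈ Finset.range (N + 1), h.trace (F k) * x ^ k := by
    rw [hu, ← h.trace_map, map_pow, hsum, map_sum]
    simp only [← map_pow, trace_mul_map]
  refine ⟨fun k => ↑u⁻¹ * h.trace (F k), fun k => I.mul_mem_left _ ?_, ?_⟩
  · rw [← one_mul (F k)]
    exact h.map_le_coinduced (hF k) 1
  · simp only [mul_assoc, ← Finset.mul_sum]
    rw [← htrace, Units.inv_mul_cancel_left]

end IsFixedRing

end FixedRing

section Evaluation

variable {d : ℕ}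

theorem list_prod_ofFn_mul {M : Type*} [Monoid M] {n : ℕ} {x y : Fin n → M}
    (h : ∀ i j, Commute (x i) (y j)) :
    (List.ofFn fun i => x i * y i).prod = (List.ofFn x).prod * (List.ofFn y).prod := by
  induction n with
  | zero => simp
  | succ n ih =>
    have hc : Commute (y 0) (List.ofFn fun i : Fin n => x i.succ).prod :=
      Commute.list_prod_right _ _ fun z hz => by
        obtain ⟨i, rfl⟩ := (List.mem_ofFn' _ _).1 hz
        exact (h _ _).symm
    simp only [List.ofFn_succ, List.prod_cons]
    rw [ih fun i j => h _ _, mul_assoc, ← mul_assoc (y 0), hc.eq]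
    simp only [mul_assoc]

theorem semiconjBy_list_prod_ofFn {M : Type*} [Monoid M] {n : ℕ} {w : M} {x y : Fin n → M}
    (h : ∀ i, SemiconjBy w (x i) (y i)) :
    SemiconjBy w (List.ofFn x).prod (List.ofFn y).prod := by
  induction n with
  | zero => simp
  | succ n ih =>
    simp only [List.ofFn_succ, List.prod_cons]
    exact (h 0).mul_right (ih fun i => h i.succ)

/-- For a good point `a`, the monomial `x^m` acts on `ℍ` by right multiplication by its value
`a^m`. -/
noncomputable def monomialEnd {a : Fin d → Quaternion ℝ} (ha : IsGoodPoint a) :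
    Multiplicative (Fin d →₀ ℕ) →* Module.End ℝ (Quaternion ℝ) where
  toFun m := LinearMap.mulRight ℝ (List.ofFn fun i => a i ^ m.toAdd i).prod
  map_one' := by simp [Module.End.one_eq_id]
  map_mul' m n := by
    simp only [mul_comm m n, toAdd_mul, Finsupp.add_apply, pow_add]
    rw [list_prod_ofFn_mul fun i j => (show Commute (a i) (a j) from ha i j).pow_pow _ _,
      LinearMap.mulRight_mul]
    rfl

/-- For a good point `a`, the ring `ℍ[x₁, …, x_d]` acts on `ℍ` by letting `∑ c_I x^I` send `w` to
`∑ c_I w a^I`; the value at `a` is the image of `1`. -/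
noncomputable def evalEnd {a : Fin d → Quaternion ℝ} (ha : IsGoodPoint a) :
    QuatPoly d →+* Module.End ℝ (Quaternion ℝ) :=
  AddMonoidAlgebra.liftNCRingHom (Algebra.lmul ℝ (Quaternion ℝ)).toRingHom (monomialEnd ha)
    fun c _ => LinearMap.ext fun w => (mul_assoc c w _).symm

variable {a b : Fin d → Quaternion ℝ}

theorem evalEnd_single (ha : IsGoodPoint a) (m : Fin d →₀ ℕ) (c w : Quaternion ℝ) :
    evalEnd ha (AddMonoidAlgebra.single m c) w =
      c * (w * (List.ofFn fun i => a i ^ m i).prod) :=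
  LinearMap.congr_fun (AddMonoidAlgebra.liftNC_single _ _ _ _) w

theorem evalEnd_quatConst (ha : IsGoodPoint a) (c w : Quaternion ℝ) :
    evalEnd ha (quatConst c) w = c * w := by
  simp [quatConst, evalEnd_single]

theorem quatEval_mul_eq_evalEnd (ha : IsGoodPoint a) {w : Quaternion ℝ}
    (h : ∀ i, SemiconjBy w (a i) (b i)) (f : QuatPoly d) :
    quatEval b f * w = evalEnd ha f w := by
  induction f using AddMonoidAlgebra.induction_linear with
  | zero => simp [quatEval]
  | add f g hf hg =>
    rw [map_add, LinearMap.add_apply, ← hf, ← hg, ← add_mul]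
    exact congrArg (· * w) (Finsupp.sum_add_index' (fun _ => zero_mul _) fun _ _ _ => add_mul _ _ _)
  | single m c =>
    rw [evalEnd_single, (semiconjBy_list_prod_ofFn fun i => (h i).pow_right (m i)).eq, ← mul_assoc]
    exact congrArg (· * w) (Finsupp.sum_single_index (zero_mul _))

theorem evalEnd_apply_one (ha : IsGoodPoint a) (f : QuatPoly d) :
    evalEnd ha f 1 = quatEval a f := by
  rw [← quatEval_mul_eq_evalEnd ha fun i => SemiconjBy.one_left (a i), mul_one]

theorem isGoodPoint_of_semiconjBy (ha : IsGoodPoint a) {w : Quaternion ℝ} (hw : w ≠ 0)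
    (h : ∀ i, SemiconjBy w (a i) (b i)) : IsGoodPoint b := fun i j =>
  mul_right_cancel₀ hw <| by
    rw [← ((h i).mul_right (h j)).eq, ha i j, ((h j).mul_right (h i)).eq]

theorem evalEnd_quatConst_inv_mul_apply_one (ha : IsGoodPoint a) {f : QuatPoly d}
    (hf : quatEval a f ≠ 0) : evalEnd ha (quatConst (quatEval a f)⁻¹ * f) 1 = 1 := by
  rw [map_mul, Module.End.mul_apply, evalEnd_apply_one, evalEnd_quatConst, inv_mul_cancel₀ hf]

/-- The left ideal of quaternionic polynomials that vanish at a good point. -/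
noncomputable def vanishingLeftIdeal (ha : IsGoodPoint a) : Ideal (QuatPoly d) where
  carrier := {f | evalEnd ha f 1 = 0}
  zero_mem' := by
    change evalEnd ha 0 1 = 0
    rw [map_zero, LinearMap.zero_apply]
  add_mem' {f g} hf hg := by
    change evalEnd ha (f + g) 1 = 0
    rw [map_add, LinearMap.add_apply, hf, hg, add_zero]
  smul_mem' g f hf := by
    change evalEnd ha (g * f) 1 = 0
    rw [map_mul, Module.End.mul_apply, hf, map_zero]

theorem mem_vanishingLeftIdeal {ha : IsGoodPoint a} {f : QuatPoly d} :
    f ∈ vanishingLeftIdeal ha ↔ quatEval a f = 0 := by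
  rw [← evalEnd_apply_one ha]
  rfl

theorem span_le_vanishingLeftIdeal (ha : IsGoodPoint a) {ι : Type*} {g : ι → QuatPoly d}
    (hg : ∀ i, quatEval a (g i) = 0) :
    Ideal.span (Set.range g) ≤ vanishingLeftIdeal ha :=
  Ideal.span_le.2 (Set.range_subset_iff.2 fun i => mem_vanishingLeftIdeal.2 (hg i))

theorem isSemiprimeLeftIdeal_vanishingLeftIdeal (ha : IsGoodPoint a) :
    IsSemiprimeLeftIdeal (vanishingLeftIdeal ha) := by
  refine fun f hf => mem_vanishingLeftIdeal.2 (by_contra fun hfa => hfa ?_)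
  have hzero := mem_vanishingLeftIdeal.1 (hf (quatConst (quatEval a f)⁻¹))
  rwa [← evalEnd_apply_one ha, mul_assoc, map_mul, Module.End.mul_apply,
    evalEnd_quatConst_inv_mul_apply_one ha hfa, evalEnd_apply_one] at hzero

theorem quatEval_eq_zero_of_pow_mem_idealPowerSum (ha : IsGoodPoint a) {I : Ideal (QuatPoly d)}
    (hI : I ≤ vanishingLeftIdeal ha) {f : QuatPoly d}
    (h : ∀ b : Quaternion ℝ, ∃ N : ℕ,
      (quatConst b * f) ^ N ∈ idealPowerSum I (quatConst b * f) N) :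
    quatEval a f = 0 := by
  by_contra hfa
  obtain ⟨N, p, hp, hN⟩ := h (quatEval a f)⁻¹
  set F := quatConst (quatEval a f)⁻¹ * f
  have hpow : ∀ k, evalEnd ha (F ^ k) 1 = 1 := fun k => by
    induction k with
    | zero => rw [pow_zero, map_one (evalEnd ha), Module.End.one_apply]
    | succ k ih =>
      rw [pow_succ, map_mul, Module.End.mul_apply, evalEnd_quatConst_inv_mul_apply_one ha hfa, ih]
  have hterm : ∀ k, evalEnd ha (p k * F ^ k) 1 = 0 := fun k => by
    rw [map_mul, Module.End.mul_apply, hpow]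
    exact hI (hp k)
  have hone := hpow N
  rw [hN, map_sum, LinearMap.sum_apply, Finset.sum_eq_zero fun k _ => hterm k] at hone
  exact zero_ne_one hone

end Evaluation

section Complexification

variable {d : ℕ}

/-- The complex coordinates `(p, q)` of a quaternion `w = p + 𝐣 q`. -/
noncomputable def quatCoords : Quaternion ℝ ≃+ (Fin 2 → ℂ) where
  toFun w := ![quatFst w, quatSnd w]
  invFun v := v 0 + quatJ * v 1
  left_inv w := (quat_eq_fst_add_j_mul_snd w).symm
  right_inv v := by
    have hre : quatJ.re = 0 := rfl
    have hi : quatJ.imI = 0 := rfl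
    have hj : quatJ.imJ = 1 := rfl
    have hk : quatJ.imK = 0 := rfl
    ext i
    fin_cases i <;> apply Complex.ext <;> simp [quatFst, quatSnd, hre, hi, hj, hk]
  map_add' w z := by simp

theorem quatCoords_apply (w : Quaternion ℝ) : quatCoords w = ![quatFst w, quatSnd w] :=
  rfl

theorem quatFst_quatCoords_symm (v : Fin 2 → ℂ) : quatFst (quatCoords.symm v) = v 0 :=
  congrFun (quatCoords.apply_symm_apply v) 0

theorem quatSnd_quatCoords_symm (v : Fin 2 → ℂ) : quatSnd (quatCoords.symm v) = v 1 :=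
  congrFun (quatCoords.apply_symm_apply v) 1

theorem quatEmbed_injective : Function.Injective (quatEmbed d) := by
  intro f g h
  have hfst : polyFst f = polyFst g := congrFun (congrFun h 0) 0
  have hsnd : polySnd f = polySnd g := congrFun (congrFun h 1) 0
  refine AddMonoidAlgebra.ext (Finsupp.ext fun m => quatCoords.injective ?_)
  exact congrArg₂ (fun p q => ![p, q]) (congrArg (MvPolynomial.coeff m) hfst)
    (congrArg (MvPolynomial.coeff m) hsnd)

theorem exists_polyFst_eq_polySnd_eq (p q : MvPolynomial (Fin d) ℂ) :
    ∃ f : QuatPoly d, polyFst f = p ∧ polySnd f = q := by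
  let κ (k : Fin 2) : ℂ →+ Quaternion ℝ :=
    quatCoords.symm.toAddMonoidHom.comp (AddMonoidHom.single (fun _ => ℂ) k)
  refine ⟨AddMonoidAlgebra.map (κ 0) p + AddMonoidAlgebra.map (κ 1) q, ?_, ?_⟩
  · refine MvPolynomial.ext _ _ fun m => ?_
    change quatFst (κ 0 (p.coeff m) + κ 1 (q.coeff m)) = p.coeff m
    simp [κ, quatFst_quatCoords_symm]
  · refine MvPolynomial.ext _ _ fun m => ?_
    change quatSnd (κ 0 (p.coeff m) + κ 1 (q.coeff m)) = q.coeff m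
    simp [κ, quatSnd_quatCoords_symm]

/-- The conjugation `F ↦ J F̄ J⁻¹`, with `J = [[0, -1], [1, 0]]`, of `M₂(ℂ[x₁, …, x_d])`. -/
noncomputable def matConj (d : ℕ) :
    Matrix (Fin 2) (Fin 2) (MvPolynomial (Fin d) ℂ) →+*
      Matrix (Fin 2) (Fin 2) (MvPolynomial (Fin d) ℂ) where
  toFun F := !![polyConj (F 1 1), -polyConj (F 1 0); -polyConj (F 0 1), polyConj (F 0 0)]
  map_one' := by ext1 i j; fin_cases i <;> fin_cases j <;> simp
  map_mul' F G := by
    simp only [mul_apply, Fin.sum_univ_two, map_add, map_mul, mul_fin_two]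
    ring_nf
  map_zero' := by ext1 i j; fin_cases i <;> fin_cases j <;> simp
  map_add' F G := by ext1 i j; fin_cases i <;> fin_cases j <;> simp [add_comm]

theorem isFixedRing_quatEmbed : IsFixedRing (quatEmbed d) (matConj d) where
  injective := quatEmbed_injective
  involutive F := by
    ext1 i j
    fin_cases i <;> fin_cases j <;> simp [matConj, polyConj_polyConj]
  mem_range_iff F := by
    constructor
    · rintro ⟨f, rfl⟩
      ext1 i j
      fin_cases i <;> fin_cases j <;> simp [matConj, quatEmbed, polyConj_polyConj]
    · intro hF
      obtain ⟨f, hfst, hsnd⟩ := exists_polyFst_eq_polySnd_eq (F 0 0) (F 1 0)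
      have h01 : -polyConj (polySnd f) = F 0 1 := by rw [hsnd]; exact congrFun (congrFun hF 0) 1
      have h11 : polyConj (polyFst f) = F 1 1 := by rw [hfst]; exact congrFun (congrFun hF 1) 1
      refine ⟨f, ?_⟩
      rw [eta_fin_two F, ← hfst, ← hsnd, ← h01, ← h11]
      rfl

theorem isUnit_two_quatPoly : IsUnit (2 : QuatPoly d) := by
  have h : IsUnit (algebraMap ℝ (QuatPoly d) 2) := (isUnit_iff_ne_zero.2 two_ne_zero).map _
  rwa [map_ofNat] at h

theorem quatEmbed_quatConst (b : Quaternion ℝ) : quatEmbed d (quatConst b) =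
    matConst !![quatFst b, -starRingEnd ℂ (quatSnd b); quatSnd b, starRingEnd ℂ (quatFst b)] := by
  ext1 i j
  fin_cases i <;> fin_cases j <;>
    simp [quatEmbed, quatConst, matConst, polyFst_single, polySnd_single, polyConj,
      ← MvPolynomial.C_apply]

theorem isGoodPoint_coe (c : Fin d → ℂ) : IsGoodPoint fun i => (c i : Quaternion ℝ) := fun i j => by
  rw [← Quaternion.coeComplex_mul, mul_comm, Quaternion.coeComplex_mul]

theorem quatCoords_mul_coe (w : Quaternion ℝ) (z : ℂ) :
    quatCoords (w * (z : Quaternion ℝ)) = z • quatCoords w := by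
  have hfst : quatFst (z : Quaternion ℝ) = z := by apply Complex.ext <;> simp [quatFst]
  have hsnd : quatSnd (z : Quaternion ℝ) = 0 := by apply Complex.ext <;> simp [quatSnd]
  ext i
  fin_cases i <;> simp [quatCoords_apply, quatFst_mul, quatSnd_mul, hfst, hsnd, mul_comm z]

theorem quatCoords_mul (z w : Quaternion ℝ) : quatCoords (z * w) =
    !![quatFst z, -starRingEnd ℂ (quatSnd z); quatSnd z, starRingEnd ℂ (quatFst z)] *ᵥ
      quatCoords w := by
  ext i
  fin_cases i <;> simp [quatCoords_apply, quatFst_mul, quatSnd_mul, sub_eq_add_neg, mul_comm]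

theorem matEval_quatEmbed_single (c : Fin d → ℂ) (m : Fin d →₀ ℕ) (z : Quaternion ℝ) :
    matEval c (quatEmbed d (AddMonoidAlgebra.single m z)) = (∏ i, c i ^ m i) •
      !![quatFst z, -starRingEnd ℂ (quatSnd z); quatSnd z, starRingEnd ℂ (quatFst z)] := by
  have hP (r : ℂ) :
      MvPolynomial.eval c (MvPolynomial.monomial m r) = (∏ i, c i ^ m i) * r := by
    rw [MvPolynomial.eval_monomial, Finsupp.prod_fintype _ _ fun i => pow_zero _, mul_comm]
  ext i j
  fin_cases i <;> fin_cases j <;>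
    simp [matEval, quatEmbed, polyFst_single, polySnd_single, polyConj, hP]

theorem list_prod_ofFn_coe_pow (c : Fin d → ℂ) (m : Fin d →₀ ℕ) :
    (List.ofFn fun i => (c i : Quaternion ℝ) ^ m i).prod =
      ((∏ i, c i ^ m i : ℂ) : Quaternion ℝ) := by
  rw [← List.prod_ofFn, ← Quaternion.coe_ofComplex, map_list_prod, List.map_ofFn]
  congr 2
  ext1 i
  exact (map_pow Quaternion.ofComplex _ _).symm

theorem quatCoords_evalEnd (c : Fin d → ℂ) (f : QuatPoly d) (w : Quaternion ℝ) :
    quatCoords (evalEnd (isGoodPoint_coe c) f w) = matEval c (quatEmbed d f) *ᵥ quatCoords w := by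
  induction f using AddMonoidAlgebra.induction_linear with
  | zero => simp [matEval]
  | add f g hf hg =>
    rw [map_add, LinearMap.add_apply, map_add, hf, hg, map_add, ← add_mulVec]
    exact congrArg (· *ᵥ quatCoords w) (Matrix.map_add _ (map_add _) _ _).symm
  | single m z =>
    rw [evalEnd_single, list_prod_ofFn_coe_pow, ← mul_assoc, quatCoords_mul_coe, quatCoords_mul,
      matEval_quatEmbed_single, smul_mulVec]

theorem exists_isGoodPoint_quatEval_eq_zero_iff (c : Fin d → ℂ) {v : Fin 2 → ℂ} (hv : v ≠ 0) :
    ∃ a : Fin d → Quaternion ℝ, IsGoodPoint a ∧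
      ∀ f : QuatPoly d, quatEval a f = 0 ↔ matEval c (quatEmbed d f) *ᵥ v = 0 := by
  obtain ⟨w, rfl⟩ := quatCoords.surjective v
  have hw : w ≠ 0 := fun hw => hv (by rw [hw, map_zero])
  have hc : ∀ i, SemiconjBy w (c i : Quaternion ℝ) (w * c i * w⁻¹) := fun i => by
    simp [SemiconjBy, hw]
  refine ⟨_, isGoodPoint_of_semiconjBy (isGoodPoint_coe c) hw hc, fun f => ?_⟩
  rw [← quatCoords_evalEnd, map_eq_zero_iff _ quatCoords.injective,
    ← quatEval_mul_eq_evalEnd _ hc, mul_eq_zero_iff_right hw]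

theorem map_algHom_eq_matEval (χ : MvPolynomial (Fin d) ℂ →ₐ[ℂ] ℂ)
    (F : Matrix (Fin 2) (Fin 2) (MvPolynomial (Fin d) ℂ)) :
    F.map χ = matEval (fun i => χ (MvPolynomial.X i)) F :=
  Matrix.ext fun i j => (DFunLike.congr_fun (MvPolynomial.aeval_unique χ) (F i j)).trans
    (DFunLike.congr_fun (MvPolynomial.coe_aeval_eq_eval _) (F i j))

theorem map_span_range_quatEmbed {ι : Type*} (g : ι → QuatPoly d) :
    Ideal.span (Set.range fun i => quatEmbed d (g i)) =
      (Ideal.span (Set.range g)).map (quatEmbed d) := by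
  rw [Ideal.map_span, ← Set.range_comp]
  rfl

end Complexification

section Nullstellensatz

variable {d : ℕ} {ι : Type*} {g : ι → QuatPoly d} {f : QuatPoly d}

theorem quatEmbed_mem_semiprimeClosure
    (h : ∀ (c : Fin d → ℂ) (v : Fin 2 → ℂ),
      (∀ i, matEval c (quatEmbed d (g i)) *ᵥ v = 0) → matEval c (quatEmbed d f) *ᵥ v = 0) :
    quatEmbed d f ∈ semiprimeClosure (Ideal.span (Set.range fun i => quatEmbed d (g i))) := by
  refine Submodule.mem_sInf.2 fun J ⟨hIJ, hJ⟩ => by_contra fun hf => ?_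
  obtain ⟨χ, w, hw, hfw⟩ := hJ.exists_algHom_mulVec_ne_zero (K := ℂ) hf
  simp only [map_algHom_eq_matEval] at hw hfw
  exact hfw (h _ w fun i => hw _ (hIJ (Ideal.subset_span ⟨i, rfl⟩)))

theorem exists_pow_mem_idealPowerSum_matConst_mul
    (h : ∀ (c : Fin d → ℂ) (v : Fin 2 → ℂ),
      (∀ i, matEval c (quatEmbed d (g i)) *ᵥ v = 0) → matEval c (quatEmbed d f) *ᵥ v = 0)
    (A : Matrix (Fin 2) (Fin 2) ℂ) :
    ∃ N : ℕ, (matConst A * quatEmbed d f) ^ N ∈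
      idealPowerSum (Ideal.span (Set.range fun i => quatEmbed d (g i)))
        (matConst A * quatEmbed d f) N := by
  refine exists_pow_mem_idealPowerSum_of_eigenvalues_eq_zero (K := ℂ) fun χ w hw hI t ht => ?_
  have hfw : (quatEmbed d f).map χ *ᵥ w = 0 := by
    rw [map_algHom_eq_matEval]
    exact h _ w fun i => by
      rw [← map_algHom_eq_matEval]
      exact hI _ (Ideal.subset_span ⟨i, rfl⟩)
  rw [Matrix.map_mul, ← mulVec_mulVec, hfw, mulVec_zero] at ht
  exact (smul_eq_zero.1 ht.symm).resolve_right hw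

end Nullstellensatz

theorem theorem6p3_general {d : ℕ} {ι : Type*} (g : ι → QuatPoly d) (f : QuatPoly d) :
    List.TFAE [
      ∀ a : Fin d → Quaternion ℝ, IsGoodPoint a →
        (∀ i, quatEval a (g i) = 0) → quatEval a f = 0,
      ∀ (c : Fin d → ℂ) (u v : ℂ),
        (∀ i, matEval c (quatEmbed d (g i)) *ᵥ ![u, v] = 0) →
          matEval c (quatEmbed d f) *ᵥ ![u, v] = 0,
      quatEmbed d f ∈ semiprimeClosure (Ideal.span (Set.range fun i => quatEmbed d (g i))),
      f ∈ semiprimeClosure (Ideal.span (Set.range g)),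
      ∀ A : Matrix (Fin 2) (Fin 2) ℂ, ∃ N : ℕ, (matConst A * quatEmbed d f) ^ N ∈
        idealPowerSum (Ideal.span (Set.range fun i => quatEmbed d (g i)))
          (matConst A * quatEmbed d f) N,
      ∀ b : Quaternion ℝ, ∃ N : ℕ, (quatConst b * f) ^ N ∈
        idealPowerSum (Ideal.span (Set.range g)) (quatConst b * f) N] := by
  tfae_have 1 → 2 := fun h c u v hg => by
    by_cases hv : ![u, v] = 0
    · rw [hv, mulVec_zero]
    obtain ⟨a, ha, hac⟩ := exists_isGoodPoint_quatEval_eq_zero_iff c hv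
    exact (hac f).1 (h a ha fun i => (hac (g i)).2 (hg i))
  have hv (v : Fin 2 → ℂ) : ![v 0, v 1] = v := List.ofFn_injective rfl
  tfae_have 2 → 3 := fun h =>
    quatEmbed_mem_semiprimeClosure fun c v => hv v ▸ h c (v 0) (v 1)
  tfae_have 3 → 4 := fun h =>
    isFixedRing_quatEmbed.mem_semiprimeClosure_of_map_mem isUnit_two_quatPoly
      (map_span_range_quatEmbed g ▸ h)
  tfae_have 4 → 1 := fun h a ha hg => mem_vanishingLeftIdeal.1 <| Submodule.mem_sInf.1 h _
    ⟨span_le_vanishingLeftIdeal ha hg, isSemiprimeLeftIdeal_vanishingLeftIdeal ha⟩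
  tfae_have 2 → 5 := fun h =>
    exists_pow_mem_idealPowerSum_matConst_mul fun c v => hv v ▸ h c (v 0) (v 1)
  tfae_have 5 → 6 := fun h b => by
    obtain ⟨N, hN⟩ := h _
    rw [← quatEmbed_quatConst b, ← map_mul, map_span_range_quatEmbed] at hN
    exact ⟨N, isFixedRing_quatEmbed.pow_mem_idealPowerSum_of_map_pow_mem isUnit_two_quatPoly hN⟩
  tfae_have 6 → 1 := fun h a ha hg =>
    quatEval_eq_zero_of_pow_mem_idealPowerSum ha (span_le_vanishingLeftIdeal ha hg) h
  tfae_finish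

theorem theorem6p3 {d m : ℕ} (g : Fin m → QuatPoly d) (f : QuatPoly d)
    (I : Ideal (QuatPoly d)) (hI : I = Ideal.span (Set.range g))
    (I' : Ideal (Matrix (Fin 2) (Fin 2) (MvPolynomial (Fin d) ℂ)))
    (hI' : I' = Ideal.span (Set.range fun i => quatEmbed d (g i))) :
    List.TFAE [
      ∀ a : Fin d → Quaternion ℝ, IsGoodPoint a →
        (∀ i, quatEval a (g i) = 0) → quatEval a f = 0,
      ∀ (c : Fin d → ℂ) (u v : ℂ),
        (∀ i, (matEval c (quatEmbed d (g i))).mulVec ![u, v] = 0) →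
          (matEval c (quatEmbed d f)).mulVec ![u, v] = 0,
      quatEmbed d f ∈ semiprimeClosure I',
      f ∈ semiprimeClosure I,
      ∀ A : Matrix (Fin 2) (Fin 2) ℂ, ∃ N : ℕ,
        (matConst A * quatEmbed d f) ^ N ∈ idealPowerSum I' (matConst A * quatEmbed d f) N,
      ∀ b : Quaternion ℝ, ∃ N : ℕ,
        (quatConst b * f) ^ N ∈ idealPowerSum I (quatConst b * f) N] := by
  subst hI hI'
  exact theorem6p3_general g f
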